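/- Let $\mathcal{C}$ be a model category (a category with finite limits and finite colimits, with cofibrations, fibrations and weak equivalences satisfying the axioms of a closed model category). Let $\mathcal{C}^\to$ be its arrow category, with objects $(X,A,x)$ where $x:X\to A$, and with morphisms $(p,f):(X,A,x)\to(Y,B,y)$ where $yp=fx$. Call $(X,A,x)$ fibrant if $x$ is a fibration, and cofibrant if $X$ is cofibrant in $\mathcal{C}$; let $(\mathcal{C}^\to)_{fb}$ and $(\mathcal{C}^\to)_{cfb}$ be the full subcategories of fibrant and of cofibrant-fibrant objects. Two morphisms $(p,f),(q,f):(X,A,x)\to(Y,B,y)$ over the same $f$ are fiberwise-homotopic if for some cylinder object $X+X\xrightarrow{[\partial_1,\partial_2]}X\times I\xrightarrow{\sigma}X$ (with $\sigma[\partial_1,\partial_2]=\nabla_X$ and $\sigma$ a weak equivalence) there is $h:X\times I\to Y$ with $h\partial_1=p$, $h\partial_2=q$ and $yh=fx\sigma$. Let $\pi(\mathcal{C}^\to)_{cfb}$ be the quotient of $(\mathcal{C}^\to)_{cfb}$ by this relation. For every fibrant $P=(X,A,x)$ choose a cofibrant replacement $q_P:QP\to P$ over $\mathrm{id}_A$,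 i.e. a trivial fibration $X'\to X$ with $X'$ cofibrant, $QP=(X',A,X'\to X\to A)$ (this is cofibrant-fibrant). Let $\mathrm{Ho}(\mathcal{C}^\to)_{fb}$ be the category with the same objects as $(\mathcal{C}^\to)_{fb}$ and with $\mathrm{Hom}(P,P')=\mathrm{Hom}_{\pi(\mathcal{C}^\to)_{cfb}}(QP,QP')$. Let $\mathrm{F}_{fb}(\mathcal{C}):(\mathcal{C}^\to)_{fb}\to\mathcal{C}$ and $\mathrm{HoF}_{fb}(\mathcal{C}):\mathrm{Ho}(\mathcal{C}^\to)_{fb}\to\mathcal{C}$ be the codomain functors $(X,A,x)\mapsto A$, $(p,f)\mapsto f$ and $[(p,f)]\mapsto f$. Let $\gamma:(\mathcal{C}^\to)_{fb}\to\mathrm{Ho}(\mathcal{C}^\to)_{fb}$ be the functor that is the identity on objects and sends $p:P\to P'$ to the class of any $\tilde p:QP\to QP'$ with $q_{P'}\tilde p=p\,q_P$. A functor $\mathbf{E}:\mathcal{E}\to\mathcal{B}$ is a $\wedge$-fibration if it is a Grothendieck fibration; each fiber $\mathbf{E}^A$ (objects over $A$, morphisms over $\mathrm{id}_A$) has a terminal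 object and binary products; if $T'\to T$ is cartesian over $f:A'\to A$ and $T$ is terminal in $\mathbf{E}^A$, then $T'$ is terminal in $\mathbf{E}^{A'}$; and if $P\leftarrow W\to R$ is a product diagram in $\mathbf{E}^A$, $P'\leftarrow W'\to R'$ is a diagram in $\mathbf{E}^{A'}$, and $P'\to P$, $W'\to W$, $R'\to R$ are cartesian over $f$ and commute with these, then $P'\leftarrow W'\to R'$ is a product diagram in $\mathbf{E}^{A'}$. A morphism of $\wedge$-fibrations $\mathbf{E}\to\mathbf{E}'$ over $\mathcal{B}$ is a functor $F:\mathcal{E}\to\mathcal{E}'$ between the total categories of two $\wedge$-fibrations with $\mathbf{E}'F=\mathbf{E}$, which takes cartesian morphisms to cartesian morphisms and whose induced functors on fibers take terminal objects to terminal objects and binary product diagrams to binary product diagrams. Proposition. For any model category $\mathcal{C}$ (and any choice of the cofibrant replacements), $\mathrm{HoF}_{fb}(\mathcal{C})$ is a $\wedge$-fibration, and $\gamma:\mathrm{F}_{fb}(\mathcal{C})\to\mathrm{HoF}_{fb}(\mathcal{C})$ is a morphism of $\wedge$-fibrations. -/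

import Mathlib

open CategoryTheory CategoryTheory.Limits HomotopicalAlgebra

universe v u

namespace WedgeFib

section Fibrations

universe v₁ u₁ v₂ u₂ v₃ u₃

/-- A finite product category: it has a terminal object and a product diagram over each pair of
objects. -/
structure IsFPCategory (D : Type u₁) [Category.{v₁} D] : Prop where
  hasTerminal : HasTerminal D
  hasBinaryProducts : HasBinaryProducts D

/-- `P ←π₁- W -π₂→ Q` is a product diagram. -/
def IsProductDiagram {D : Type u₁} [Category.{v₁} D] {P Q W : D} (π₁ : W ⟶ P) (π₂ : W ⟶ Q) :
    Prop :=
  Nonempty (IsLimit (BinaryFan.mk π₁ π₂))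

/-- A functor is an f.p. functor if it takes terminal objects to terminal objects and product
diagrams to product diagrams. -/
structure IsFPFunctor {D : Type u₁} [Category.{v₁} D] {E : Type u₂} [Category.{v₂} E]
    (G : D ⥤ E) : Prop where
  map_terminal (T : D) : Nonempty (IsTerminal T) → Nonempty (IsTerminal (G.obj T))
  map_product {P Q W : D} (π₁ : W ⟶ P) (π₂ : W ⟶ Q) :
    IsProductDiagram π₁ π₂ → IsProductDiagram (G.map π₁) (G.map π₂)

variable {𝒳 : Type u₁} [Category.{v₁} 𝒳] {𝒴 : Type u₂} [Category.{v₂} 𝒴]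
  {B : Type u₃} [Category.{v₃} B]

/-- `p : 𝒳 ⥤ B` is a `∧`-fibration: it is a Grothendieck fibration, its fibers are f.p. categories,
and terminal objects and binary products in the fibers are stable under pullback along
cartesian morphisms. -/
structure IsWedgeFibration (p : 𝒳 ⥤ B) : Prop where
  isFibered : p.IsFibered
  fiber_fp (A : B) : IsFPCategory (p.Fiber A)
  terminal_stable {A A' : B} (f : A' ⟶ A) (T : p.Fiber A) (T' : p.Fiber A') (c : T'.1 ⟶ T.1) :
    p.IsStronglyCartesian f c → Nonempty (IsTerminal T) → Nonempty (IsTerminal T')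
  product_stable {A A' : B} (f : A' ⟶ A) {P Q W : p.Fiber A} {P' Q' W' : p.Fiber A'}
    (π₁ : W ⟶ P) (π₂ : W ⟶ Q) (π₁' : W' ⟶ P') (π₂' : W' ⟶ Q')
    (cP : P'.1 ⟶ P.1) (cQ : Q'.1 ⟶ Q.1) (cW : W'.1 ⟶ W.1) :
    p.IsStronglyCartesian f cP → p.IsStronglyCartesian f cQ → p.IsStronglyCartesian f cW →
    π₁'.1 ≫ cP = cW ≫ π₁.1 → π₂'.1 ≫ cQ = cW ≫ π₂.1 →
    IsProductDiagram π₁ π₂ → IsProductDiagram π₁' π₂'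

/-- The functor between the fibers over `A` induced by a morphism of prefibrations. -/
def fiberMap {p : 𝒳 ⥤ B} {q : 𝒴 ⥤ B} (F : 𝒳 ⥤ 𝒴) (w : F ⋙ q = p) (A : B) :
    p.Fiber A ⥤ q.Fiber A :=
  Functor.Fiber.inducedFunctor (F := (Functor.Fiber.fiberInclusion : p.Fiber A ⥤ 𝒳) ⋙ F)
    (by rw [Functor.assoc, w]; exact Functor.Fiber.fiberInclusion_comp_eq_const)

/-- `F` is a morphism of `∧`-fibrations from `p` to `q`: both are `∧`-fibrations, `F` lies strictly
over the base, takes cartesian morphisms to cartesian morphisms, and induces f.p. functors on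
all the fibers. -/
structure IsWedgeFibrationMorphism (p : 𝒳 ⥤ B) (q : 𝒴 ⥤ B) (F : 𝒳 ⥤ 𝒴) : Prop where
  source : IsWedgeFibration p
  target : IsWedgeFibration q
  comm : F ⋙ q = p
  map_cartesian {A A' : B} (f : A' ⟶ A) {P' P : 𝒳} (c : P' ⟶ P) :
    p.IsStronglyCartesian f c → q.IsStronglyCartesian f (F.map c)
  fiber_fp (A : B) : IsFPFunctor (fiberMap F comm A)

end Fibrations

section Model

variable (C : Type u) [Category.{v} C] [ModelCategory C]

/-- The fibrant objects of the arrow category: the arrows that are fibrations, i.e. the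
arrows `x : X ⟶ A` that are fibrant as objects of the slice over `A`. -/
def fibrantArrows : ObjectProperty (Arrow C) := fun P => Fibration P.hom

/-- The cofibrant-fibrant objects of the arrow category: the arrows `x : X ⟶ A` that are
cofibrant and fibrant as objects of the slice over `A`, i.e. `X` is cofibrant in `C`
and `x` is a fibration. -/
def bifibrantArrows : ObjectProperty (Arrow C) := fun P => IsCofibrant P.left ∧ Fibration P.hom

/-- The full subcategory of fibrant objects of the arrow category. -/
abbrev FibArrow : Type (max u v) := (fibrantArrows C).FullSubcategory

/-- The full subcategory of cofibrant-fibrant objects of the arrow category. -/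
abbrev BifibArrow : Type (max u v) := (bifibrantArrows C).FullSubcategory

/-- The prefibration `F_fb(C)`: the codomain functor on the fibrant objects of the arrow category. -/
def codFib : FibArrow C ⥤ C := (fibrantArrows C).ι ⋙ Arrow.rightFunc

/-- The codomain functor on the cofibrant-fibrant objects of the arrow category. -/
def codBifib : BifibArrow C ⥤ C := (bifibrantArrows C).ι ⋙ Arrow.rightFunc

variable {C}

/-- `p` and `q` lie over the same morphism of `C`, and there is a left homotopy `h` from
`p.left` to `q.left`, on some cylinder object `σ : c.I ⟶ P.left`, which is fiberwise, that is,
such that `Q.hom ∘ h = p.right ∘ P.hom ∘ σ`. -/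
def FiberwiseHomotopic {P Q : Arrow C} (p q : P ⟶ Q) : Prop :=
  p.right = q.right ∧ ∃ (c : Cylinder P.left) (h : c.LeftHomotopy p.left q.left),
    h.h ≫ Q.hom = c.π ≫ P.hom ≫ p.right

variable (C)

/-- Fiberwise homotopy on the cofibrant-fibrant objects of the arrow category. -/
def fiberwiseHomRel : HomRel (BifibArrow C) := fun _ _ p q => FiberwiseHomotopic p.hom q.hom

/-- The quotient category of the category of cofibrant-fibrant objects of the arrow category by
fiberwise homotopy. -/
abbrev PiArrow : Type (max u v) := CategoryTheory.Quotient (fiberwiseHomRel C)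

/-- The functor to `C` induced by the codomain functor on the quotient by fiberwise homotopy. -/
def codPi : PiArrow C ⥤ C :=
  CategoryTheory.Quotient.lift _ (codBifib C) (fun _ _ _ _ h => h.1)

variable {C} in
/-- Two morphisms which become equal after composition with a trivial fibration are left homotopic,
by a homotopy that becomes constant. -/
theorem exists_leftHomotopy_of_comp_eq {X Y' Y : C} (q : Y' ⟶ Y) [Fibration q] [WeakEquivalence q]
    (s t : X ⟶ Y') (h : s ≫ q = t ≫ q) :
    ∃ (c : Cylinder X) (k : c.LeftHomotopy s t), k.h ≫ q = c.π ≫ s ≫ q := by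
  obtain ⟨c, _⟩ := Cylinder.exists_very_good X
  have sq : CommSq (coprod.desc s t) c.i q (c.π ≫ s ≫ q) := by
    refine ⟨coprod.hom_ext ?_ ?_⟩
    · rw [coprod.inl_desc_assoc, Precylinder.inl_i_assoc, Precylinder.i₀_π_assoc]
    · rw [coprod.inr_desc_assoc, Precylinder.inr_i_assoc, Precylinder.i₁_π_assoc, h]
  exact ⟨c, ⟨sq.lift, by rw [← Precylinder.inl_i, Category.assoc, sq.fac_left, coprod.inl_desc],
    by rw [← Precylinder.inr_i, Category.assoc, sq.fac_left, coprod.inr_desc]⟩, sq.fac_right⟩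

/-- A choice, for every fibrant object `x : X ⟶ A` of the arrow category, of a cofibrant replacement
in the slice over `A`: a trivial fibration `q : X' ⟶ X` with `X'` cofibrant. The replacement is then
the object `q ≫ x : X' ⟶ A` of the slice. -/
structure CofibrantReplacements where
  obj (P : FibArrow C) : C
  map (P : FibArrow C) : obj P ⟶ P.obj.left
  cofibrant (P : FibArrow C) : IsCofibrant (obj P)
  fibration (P : FibArrow C) : Fibration (map P)
  weakEquivalence (P : FibArrow C) : WeakEquivalence (map P)

namespace CofibrantReplacements

/-- Cofibrant replacements can be chosen so that nothing is changed where the domain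
of the arrow is already cofibrant. -/
theorem exists_normalized : ∃ Q : CofibrantReplacements C, ∀ P : FibArrow C,
    IsCofibrant P.obj.left → ∃ e : Q.obj P = P.obj.left, Q.map P = eqToHom e := by
  classical
  have key : ∀ P : FibArrow C, ∃ (X : C) (q : X ⟶ P.obj.left), IsCofibrant X ∧ Fibration q ∧
      WeakEquivalence q ∧ (IsCofibrant P.obj.left → ∃ e : X = P.obj.left, q = eqToHom e) := by
    intro P
    by_cases hP : IsCofibrant P.obj.left
    · exact ⟨_, 𝟙 _, hP, inferInstance, inferInstance, fun _ => ⟨rfl, rfl⟩⟩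
    · let d := MorphismProperty.factorizationData (cofibrations C) (trivialFibrations C)
        (initial.to P.obj.left)
      have hd := (mem_trivialFibrations_iff d.p).1 d.hp
      refine ⟨d.Z, d.p, ?_, hd.1, hd.2, fun h => (hP h).elim⟩
      rw [isCofibrant_iff, Subsingleton.elim (initial.to d.Z) d.i]
      exact (cofibration_iff _).2 d.hi
  choose X q h₁ h₂ h₃ h₄ using key
  exact ⟨⟨X, q, h₁, h₂, h₃⟩, h₄⟩

variable {C} (Q : CofibrantReplacements C)

/-- The chosen cofibrant replacement in the slice. It is cofibrant-fibrant, a composite of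
fibrations being a fibration; so no further fibrant replacement is needed. -/
def bifib (P : FibArrow C) : BifibArrow C :=
  ⟨Arrow.mk (Q.map P ≫ P.obj.hom), Q.cofibrant P, by
    have := Q.fibration P
    have : Fibration P.obj.hom := P.property
    dsimp
    infer_instance⟩

/-- The replacement morphism, as a morphism of the arrow category over an identity. -/
def toArrow (P : FibArrow C) : (Q.bifib P).obj ⟶ P.obj :=
  Arrow.homMk (u := Q.map P) (v := 𝟙 P.obj.right)
    (Category.comp_id (Q.map P ≫ P.obj.hom)).symm

/-- Two morphisms between replacements which induce the same morphism to `P'` are fiberwise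
homotopic. -/
theorem homotopic_of_comp_eq {P : BifibArrow C} {P' : FibArrow C} (s t : P ⟶ Q.bifib P')
    (h : s.hom ≫ Q.toArrow P' = t.hom ≫ Q.toArrow P') : FiberwiseHomotopic s.hom t.hom := by
  have := Q.fibration P'
  have := Q.weakEquivalence P'
  have hl : s.hom.left ≫ Q.map P' = t.hom.left ≫ Q.map P' := congrArg CommaMorphism.left h
  have hr : s.hom.right ≫ 𝟙 P'.obj.right = t.hom.right ≫ 𝟙 P'.obj.right :=
    congrArg CommaMorphism.right h
  refine ⟨(Category.comp_id _).symm.trans (hr.trans (Category.comp_id _)), ?_⟩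
  obtain ⟨c, k, hk⟩ := exists_leftHomotopy_of_comp_eq (Q.map P') s.hom.left t.hom.left hl
  refine ⟨c, k, ?_⟩
  have hs : s.hom.left ≫ Q.map P' ≫ P'.obj.hom = P.obj.hom ≫ s.hom.right := Arrow.w s.hom
  have key : ∀ {I X Y' Y A B : C} (k : I ⟶ Y') (σ : I ⟶ X) (s : X ⟶ Y') (q : Y' ⟶ Y) (y : Y ⟶ B)
      (x : X ⟶ A) (r : A ⟶ B), k ≫ q = σ ≫ s ≫ q → s ≫ q ≫ y = x ≫ r →
      k ≫ q ≫ y = σ ≫ x ≫ r := by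
    intro I X Y' Y A B k σ s q y x r h₁ h₂
    rw [reassoc_of% h₁, h₂]
  exact key k.h c.π s.hom.left (Q.map P') P'.obj.hom P.obj.hom s.hom.right hk hs

/-- Every morphism lifts to a morphism between the replacements. -/
theorem exists_lift {P P' : FibArrow C} (f : P ⟶ P') :
    ∃ s : Q.bifib P ⟶ Q.bifib P', s.hom ≫ Q.toArrow P' = Q.toArrow P ≫ f.hom := by
  have := Q.fibration P'
  have := Q.weakEquivalence P'
  have := Q.cofibrant P
  have sq : CommSq (initial.to (Q.obj P')) (initial.to (Q.obj P)) (Q.map P')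
      (Q.map P ≫ f.hom.left) := ⟨Subsingleton.elim _ _⟩
  have e : sq.lift ≫ Q.map P' = Q.map P ≫ f.hom.left := sq.fac_right
  have hf : f.hom.left ≫ P'.obj.hom = P.obj.hom ≫ f.hom.right := Arrow.w f.hom
  refine ⟨ObjectProperty.homMk (Arrow.homMk (u := sq.lift) (v := f.hom.right) ?_), ?_⟩
  · change sq.lift ≫ Q.map P' ≫ P'.obj.hom = (Q.map P ≫ P.obj.hom) ≫ f.hom.right
    rw [reassoc_of% e, hf, Category.assoc]
  · apply CommaMorphism.ext
    · exact e
    · change f.hom.right ≫ 𝟙 P'.obj.right = 𝟙 P.obj.right ≫ f.hom.right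
      simp

/-- A lift of `f` to the replacements; it is unique up to fiberwise homotopy. -/
noncomputable def lift {P P' : FibArrow C} (f : P ⟶ P') : Q.bifib P ⟶ Q.bifib P' :=
  (Q.exists_lift f).choose

theorem lift_spec {P P' : FibArrow C} (f : P ⟶ P') :
    (Q.lift f).hom ≫ Q.toArrow P' = Q.toArrow P ≫ f.hom :=
  (Q.exists_lift f).choose_spec

/-- The category `Ho(C^→)_fb`: its objects are the fibrant objects of the arrow category, and
the morphisms from `P` to `P'` are the fiberwise homotopy classes of morphisms between
the replacements of `P` and `P'`. -/
abbrev HoArrow : Type (max u v) :=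
  InducedCategory (PiArrow C) (fun P : FibArrow C => (CategoryTheory.Quotient.functor _).obj (Q.bifib P))

/-- The prefibration `HoF_fb(C)`: the object `x : X ⟶ A` is sent to `A`, and the class of
a morphism over `f` is sent to `f`. -/
def hoFib : Q.HoArrow ⥤ C := inducedFunctor _ ⋙ codPi C

/-- The quotient functor `γ`: it is the identity on objects, and sends a morphism to the
fiberwise homotopy class of its lifts to the replacements. -/
noncomputable def gamma : FibArrow C ⥤ Q.HoArrow where
  obj P := P
  map f := InducedCategory.homMk ((CategoryTheory.Quotient.functor _).map (Q.lift f))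
  map_id P := by
    apply InducedCategory.hom_ext
    change (CategoryTheory.Quotient.functor _).map (Q.lift (𝟙 P)) = 𝟙 ((CategoryTheory.Quotient.functor _).obj (Q.bifib P))
    refine Eq.trans ?_ ((CategoryTheory.Quotient.functor (fiberwiseHomRel C)).map_id (Q.bifib P))
    apply CategoryTheory.Quotient.sound
    apply Q.homotopic_of_comp_eq
    rw [lift_spec]
    simp
  map_comp {P P' P''} f g := by
    apply InducedCategory.hom_ext
    change (CategoryTheory.Quotient.functor _).map (Q.lift (f ≫ g)) =
      (CategoryTheory.Quotient.functor _).map (Q.lift f) ≫ (CategoryTheory.Quotient.functor _).map (Q.lift g)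
    rw [← Functor.map_comp]
    apply CategoryTheory.Quotient.sound
    apply Q.homotopic_of_comp_eq
    rw [lift_spec]
    simp only [ObjectProperty.FullSubcategory.comp_hom, Category.assoc]
    rw [lift_spec, ← Category.assoc, ← Category.assoc, lift_spec]

end CofibrantReplacements

end Model

end WedgeFib

/-! Cartesian morphisms, fiberwise terminal objects and fiberwise products that are stable under
pullback are all relative limits for the functor to the base, with one, no or two components:
`IsInitialSource`. In the arrow category these are pullback squares, identities and fiber products
over `A`. Fibrations are stable under base change and composition, so all of them stay among the
fibrant objects.

The heart is `isInitialSource_gamma`: such a strict relative limit remains one after `γ`. Lifting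
along the trivial fibration `QP' ⟶ P'` identifies morphisms `P ⟶ P'` of the homotopy category with
fiberwise homotopy classes of morphisms `QP ⟶ P'`. Fiberwise homotopy never changes the base
component, so a family of classes over a given base morphism is represented by a strict family over
that same morphism, and the strict universal property yields a factorization. For uniqueness,
homotopies between the components, taken on one common cylinder, form a family of morphisms out of
that cylinder, regarded as an arrow, and factor through the relative limit as a single homotopy
(`of_isInitialSource`).

A common cylinder exists because, for cofibrant domain and fibrant target, homotopies can be
exchanged for vertical paths, and a path yields a homotopy on any good cylinder. The same exchange
makes fiberwise homotopy a congruence. -/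

namespace WedgeFib

/-! ### Homotopy over a base: cylinders versus path objects -/

section VerticalHomotopy

variable {C : Type u} [Category.{v} C] [ModelCategory C]

/-- `p` and `q` are left homotopic by a homotopy whose projection along `y` is constant. -/
def VerticallyHomotopic {X Y B : C} (y : Y ⟶ B) (p q : X ⟶ Y) : Prop :=
  ∃ (c : Cylinder X) (h : c.LeftHomotopy p q), h.h ≫ y = c.π ≫ p ≫ y

/-- The commutative square of `p` turns one constancy condition into the other. The homotopical part
thus no longer mentions the domain arrow or the base morphism. -/
theorem fiberwiseHomotopic_iff {P Q : Arrow C} (p q : P ⟶ Q) :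
    FiberwiseHomotopic p q ↔ p.right = q.right ∧ VerticallyHomotopic Q.hom p.left q.left := by
  have w : p.left ≫ Q.hom = P.hom ≫ p.right := Arrow.w p
  unfold FiberwiseHomotopic VerticallyHomotopic
  rw [w]

/-- A path object for a morphism `y`, viewed as an object of the slice over its codomain. -/
structure VerticalPathObject {Y B : C} (y : Y ⟶ B) where
  E : C
  ι : Y ⟶ E
  r : E ⟶ pullback y y
  ι_r : ι ≫ r = pullback.diagonal y
  weakEquivalence_ι : WeakEquivalence ι
  fibration_r : Fibration r

namespace VerticalPathObject

attribute [instance] weakEquivalence_ι fibration_r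

/-- Factor the diagonal as a trivial cofibration followed by a fibration. -/
theorem nonempty {Y B : C} (y : Y ⟶ B) : Nonempty (VerticalPathObject y) := by
  let d := MorphismProperty.factorizationData (trivialCofibrations C) (fibrations C)
    (pullback.diagonal y)
  exact ⟨⟨d.Z, d.i, d.p, d.fac, inferInstance, inferInstance⟩⟩

variable {Y B : C} {y : Y ⟶ B} (E : VerticalPathObject y)

/-- The source of a vertical path. -/
noncomputable def p₀ : E.E ⟶ Y := E.r ≫ pullback.fst y y

/-- The target of a vertical path. -/
noncomputable def p₁ : E.E ⟶ Y := E.r ≫ pullback.snd y y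

theorem p₀_comp : E.p₀ ≫ y = E.p₁ ≫ y := by
  simp [p₀, p₁, pullback.condition]

@[simp]
theorem ι_p₀ : E.ι ≫ E.p₀ = 𝟙 Y := by
  rw [p₀, reassoc_of% E.ι_r, pullback.diagonal_fst]

@[simp]
theorem ι_p₁ : E.ι ≫ E.p₁ = 𝟙 Y := by
  rw [p₁, reassoc_of% E.ι_r, pullback.diagonal_snd]

instance : WeakEquivalence E.p₀ :=
  weakEquivalence_of_precomp_of_fac E.ι_p₀

/-- The first projection of `pullback y y` is a base change of `y`. Hence `p₀` is a trivial
fibration when `y` is a fibration. -/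
instance [Fibration y] : Fibration E.p₀ := by
  unfold p₀
  infer_instance

/-- Path lifting along a trivial cofibration, with prescribed endpoints. -/
theorem exists_lift {X I : C} (i : X ⟶ I) [Cofibration i] [WeakEquivalence i] (k : X ⟶ E.E)
    (a b : I ⟶ Y) (w : a ≫ y = b ≫ y) (ha : i ≫ a = k ≫ E.p₀) (hb : i ≫ b = k ≫ E.p₁) :
    ∃ K : I ⟶ E.E, i ≫ K = k ∧ K ≫ E.p₀ = a ∧ K ≫ E.p₁ = b := by
  have sq : CommSq k i E.r (pullback.lift a b w) :=
    by
    refine ⟨pullback.hom_ext ?_ ?_⟩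
    · rw [Category.assoc, Category.assoc, pullback.lift_fst, ha, p₀]
    · rw [Category.assoc, Category.assoc, pullback.lift_snd, hb, p₁]
  refine ⟨sq.lift, sq.fac_left, ?_, ?_⟩
  · rw [p₀, reassoc_of% sq.fac_right, pullback.lift_fst]
  · rw [p₁, reassoc_of% sq.fac_right, pullback.lift_snd]

end VerticalPathObject

namespace VerticallyHomotopic

variable {X Y B : C} {y : Y ⟶ B} {p q r : X ⟶ Y}

theorem comp_eq (h : VerticallyHomotopic y p q) : p ≫ y = q ≫ y := by
  obtain ⟨c, k, hk⟩ := h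
  have := congrArg (c.i₁ ≫ ·) hk
  simpa using this.symm

theorem refl (p : X ⟶ Y) : VerticallyHomotopic y p p := by
  obtain ⟨c⟩ : Nonempty (Cylinder X) := inferInstance
  exact ⟨c, .refl c p, by simp⟩

theorem symm (h : VerticallyHomotopic y p q) : VerticallyHomotopic y q p := by
  have e := h.comp_eq
  obtain ⟨c, k, hk⟩ := h
  exact ⟨c.symm, k.symm, by rw [← e]; exact hk⟩

theorem postcomp {Y' B' : C} {y' : Y' ⟶ B'} (h : VerticallyHomotopic y p q) (g : Y ⟶ Y')
    (b : B ⟶ B') (w : g ≫ y' = y ≫ b) : VerticallyHomotopic y' (p ≫ g) (q ≫ g) := by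
  obtain ⟨c, k, hk⟩ := h
  refine ⟨c, k.postcomp g, ?_⟩
  simp [w, reassoc_of% hk]

/-- Factor the inclusion of the two ends as a cofibration followed by a trivial fibration, and pull
the homotopy back along the latter. -/
theorem exists_good (h : VerticallyHomotopic y p q) :
    ∃ (c : Cylinder X) (_ : c.IsGood) (k : c.LeftHomotopy p q), k.h ≫ y = c.π ≫ p ≫ y := by
  obtain ⟨c, k, hk⟩ := h
  let d := MorphismProperty.factorizationData (cofibrations C) (trivialFibrations C) c.i
  let c' : Cylinder X :=
    { I := d.Z
      i₀ := coprod.inl ≫ d.i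
      i₁ := coprod.inr ≫ d.i
      π := d.p ≫ c.π }
  have hc' : c'.IsGood := ⟨by
    rw [show c'.i = d.i from coprod.hom_ext (by simp [c']) (by simp [c'])]
    infer_instance⟩
  exact ⟨c', hc', { h := d.p ≫ k.h }, by simp [c', hk]⟩

/-- Lift the ends of the cylinder against the trivial fibration `p₀`: the constant path at `p` on
one end, `k` on the other, all starting at `p`. The targets of the resulting paths trace the
homotopy. Only goodness of `c` is needed, not cofibrancy of `X`. -/
theorem exists_leftHomotopy_of_path [Fibration y] (E : VerticalPathObject y) (k : X ⟶ E.E)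
    (hk₀ : k ≫ E.p₀ = p) (hk₁ : k ≫ E.p₁ = q) (c : Cylinder X) [c.IsGood] :
    ∃ h : c.LeftHomotopy p q, h.h ≫ y = c.π ≫ p ≫ y := by
  have sq : CommSq (coprod.desc (p ≫ E.ι) k) c.i E.p₀ (c.π ≫ p) :=
by
    refine ⟨coprod.hom_ext ?_ ?_⟩
    · rw [coprod.inl_desc_assoc, Precylinder.inl_i_assoc, Precylinder.i₀_π_assoc,
        Category.assoc, E.ι_p₀, Category.comp_id]
    · rw [coprod.inr_desc_assoc, Precylinder.inr_i_assoc, Precylinder.i₁_π_assoc, hk₀]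
  have e₀ : c.i₀ ≫ sq.lift = p ≫ E.ι := by
    rw [← c.inl_i, Category.assoc, sq.fac_left, coprod.inl_desc]
  have e₁ : c.i₁ ≫ sq.lift = k := by
    rw [← c.inr_i, Category.assoc, sq.fac_left, coprod.inr_desc]
  refine ⟨⟨sq.lift ≫ E.p₁, ?_, ?_⟩, ?_⟩
  · rw [reassoc_of% e₀, E.ι_p₁, Category.comp_id]
  · rw [reassoc_of% e₁, hk₁]
  · rw [Category.assoc, ← E.p₀_comp, reassoc_of% sq.fac_right]

theorem of_path [Fibration y] (E : VerticalPathObject y) (k : X ⟶ E.E)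
    (hk₀ : k ≫ E.p₀ = p) (hk₁ : k ≫ E.p₁ = q) : VerticallyHomotopic y p q := by
  obtain ⟨c, _⟩ := Cylinder.exists_very_good X
  exact ⟨c, exists_leftHomotopy_of_path E k hk₀ hk₁ c⟩

/-- Vertical homotopies lift along trivial fibrations. -/
theorem of_postcomp {Y' : C} (t : Y' ⟶ Y) [Fibration t] [WeakEquivalence t] {p q : X ⟶ Y'}
    (h : VerticallyHomotopic y (p ≫ t) (q ≫ t)) : VerticallyHomotopic (t ≫ y) p q := by
  obtain ⟨c, _, k, hk⟩ := h.exists_good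
  have sq : CommSq (coprod.desc p q) c.i t k.h := by
    refine ⟨coprod.hom_ext ?_ ?_⟩
    · rw [coprod.inl_desc_assoc, Precylinder.inl_i_assoc, k.h₀]
    · rw [coprod.inr_desc_assoc, Precylinder.inr_i_assoc, k.h₁]
  refine ⟨c, ⟨sq.lift, ?_, ?_⟩, ?_⟩
  · rw [← c.inl_i, Category.assoc, sq.fac_left, coprod.inl_desc]
  · rw [← c.inr_i, Category.assoc, sq.fac_left, coprod.inr_desc]
  · rw [reassoc_of% sq.fac_right, hk, Category.assoc]

variable [IsCofibrant X]

/-- As `X` is cofibrant, `i₀` is a trivial cofibration. The constant path at `p` extends over the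
cylinder with source constantly `p` and target the homotopy; its restriction to the other end is the
required path. -/
theorem exists_path (h : VerticallyHomotopic y p q) (E : VerticalPathObject y) :
    ∃ k : X ⟶ E.E, k ≫ E.p₀ = p ∧ k ≫ E.p₁ = q := by
  obtain ⟨c, _, h, hh⟩ := h.exists_good
  obtain ⟨K, -, hK₀, hK₁⟩ := E.exists_lift c.i₀ (p ≫ E.ι) (c.π ≫ p) h.h (by simp [hh])
    (by simp) (by simp)
  exact ⟨c.i₁ ≫ K, by simp [hK₀], by simp [hK₁]⟩

/-- Start from `k` at the end `i₁`, and extend with source the homotopy and target constantly `r`.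
This composes a homotopy with a path without gluing cylinders. -/
theorem exists_path_trans (h : VerticallyHomotopic y p q) {E : VerticalPathObject y}
    {k : X ⟶ E.E} (hk₀ : k ≫ E.p₀ = q) (hk₁ : k ≫ E.p₁ = r) :
    ∃ k : X ⟶ E.E, k ≫ E.p₀ = p ∧ k ≫ E.p₁ = r := by
  have e := h.comp_eq
  obtain ⟨c, _, h, hh⟩ := h.exists_good
  obtain ⟨K, -, hK₀, hK₁⟩ := E.exists_lift c.i₁ k h.h (c.π ≫ r)
    (by rw [hh, e, ← hk₀, ← hk₁]; simp [E.p₀_comp]) (by simp [hk₀]) (by simp [hk₁])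
  exact ⟨c.i₀ ≫ K, by simp [hK₀], by simp [hK₁]⟩

/-- The homotopy can be taken on any given good cylinder. -/
theorem exists_leftHomotopy [Fibration y] (h : VerticallyHomotopic y p q) (c : Cylinder X)
    [c.IsGood] : ∃ k : c.LeftHomotopy p q, k.h ≫ y = c.π ≫ p ≫ y := by
  obtain ⟨E⟩ := VerticalPathObject.nonempty y
  obtain ⟨k, hk₀, hk₁⟩ := h.exists_path E
  exact exists_leftHomotopy_of_path E k hk₀ hk₁ c

theorem trans [Fibration y] (h : VerticallyHomotopic y p q) (h' : VerticallyHomotopic y q r) :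
    VerticallyHomotopic y p r := by
  obtain ⟨E⟩ := VerticalPathObject.nonempty y
  obtain ⟨k, hk₀, hk₁⟩ := h'.exists_path E
  obtain ⟨l, hl₀, hl₁⟩ := h.exists_path_trans hk₀ hk₁
  exact of_path E l hl₀ hl₁

/-- A cylinder on `X` need not restrict to one on `X'`, but a path `X ⟶ E.E` can simply be
precomposed. -/
theorem precomp [Fibration y] (h : VerticallyHomotopic y p q) {X' : C} (g : X' ⟶ X) :
    VerticallyHomotopic y (g ≫ p) (g ≫ q) := by
  obtain ⟨E⟩ := VerticalPathObject.nonempty y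
  obtain ⟨k, hk₀, hk₁⟩ := h.exists_path E
  exact of_path E (g ≫ k) (by simp [hk₀]) (by simp [hk₁])

end VerticallyHomotopic
end VerticalHomotopy
-- Relative limits and criteria for `∧`-fibrations
section InitialSources

universe w v₁ u₁ v₂ u₂ v₃ u₃

variable {𝒳 : Type u₁} [Category.{v₁} 𝒳] {𝒴 : Type u₂} [Category.{v₂} 𝒴]
  {B : Type u₃} [Category.{v₃} B]

/-- A source `π i : W ⟶ P i` is `p`-initial if every source whose image under `p` factors through
that of `π` has a unique factorization through `π` lying over the given one. -/
def IsInitialSource (p : 𝒳 ⥤ B) {ι : Type w} {W : 𝒳} {P : ι → 𝒳} (π : ∀ i, W ⟶ P i) : Prop :=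
  ∀ ⦃R : 𝒳⦄ (g : p.obj R ⟶ p.obj W) (u : ∀ i, R ⟶ P i), (∀ i, p.map (u i) = g ≫ p.map (π i)) →
    ∃! m : R ⟶ W, p.map m = g ∧ ∀ i, m ≫ π i = u i

/-- An empty `p`-initial source: a terminal object relative to `p`. -/
abbrev IsRelativeTerminal (p : 𝒳 ⥤ B) (T : 𝒳) : Prop :=
  IsInitialSource p (W := T) (P := fun i : PEmpty.{1} => i.elim) (fun i => i.elim)

/-- A one-element `p`-initial source. -/
abbrev IsInitialMorphism (p : 𝒳 ⥤ B) {P' P : 𝒳} (c : P' ⟶ P) : Prop :=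
  IsInitialSource p (P := fun _ : Unit => P) (fun _ => c)

/-- The family of two objects. -/
abbrev pairObj {D : Type*} (P Q : D) (b : Bool) : D := Bool.rec P Q b

/-- The source with two members. -/
abbrev pairMap {D : Type*} [Category* D] {W P Q : D} (π₁ : W ⟶ P) (π₂ : W ⟶ Q) (b : Bool) :
    W ⟶ pairObj P Q b :=
  Bool.rec (motive := fun b => W ⟶ pairObj P Q b) π₁ π₂ b

/-- A two-element `p`-initial source: a binary product relative to `p`. -/
abbrev IsRelativeProduct (p : 𝒳 ⥤ B) {W P Q : 𝒳} (π₁ : W ⟶ P) (π₂ : W ⟶ Q) : Prop :=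
  IsInitialSource p (pairMap π₁ π₂)

variable {p : 𝒳 ⥤ B} {q : 𝒴 ⥤ B}

namespace IsInitialSource

variable {ι : Type w} {W : 𝒳} {P : ι → 𝒳} {π : ∀ i, W ⟶ P i}

theorem precomp (h : IsInitialSource p π) {W' : 𝒳} {c : W' ⟶ W} (hc : IsInitialMorphism p c) :
    IsInitialSource p (fun i => c ≫ π i) := by
  intro R g u hu
  obtain ⟨m, ⟨hm₁, hm₂⟩, hm⟩ := h (g ≫ p.map c) u (fun i => by simp [hu])
  obtain ⟨n, ⟨hn₁, hn₂⟩, hn⟩ := hc g (fun _ => m) (fun _ => hm₁)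
  refine ⟨n, ⟨hn₁, fun i => by rw [reassoc_of% hn₂ (), hm₂]⟩, fun n' hn' => ?_⟩
  refine hn n' ⟨hn'.1, fun _ => hm _ ⟨by simp [hn'.1], fun i => ?_⟩⟩
  simpa using hn'.2 i

/-- Morphisms into `P i` over a fixed base morphism are determined by their composites with `c i`,
so a factorization of the composite source is already one of `π`. -/
theorem of_postcomp {P' : ι → 𝒳} {c : ∀ i, P i ⟶ P' i} (hc : ∀ i, IsInitialMorphism p (c i))
    (h : IsInitialSource p (fun i => π i ≫ c i)) : IsInitialSource p π := by
  intro R g u hu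
  obtain ⟨m, ⟨hm₁, hm₂⟩, hm⟩ := h g (fun i => u i ≫ c i) (fun i => by simp [hu])
  refine ⟨m, ⟨hm₁, fun i => ?_⟩, fun n hn => hm n ⟨hn.1, fun i => ?_⟩⟩
  · obtain ⟨_, _, hn⟩ := hc i (g ≫ p.map (π i)) (fun _ => u i ≫ c i) (fun _ => by simp [hu])
    exact (hn (m ≫ π i) ⟨by simp [hm₁], fun _ => by simpa using hm₂ i⟩).trans
      (hn (u i) ⟨hu i, fun _ => rfl⟩).symm
  · rw [← hn.2 i, Category.assoc]

end IsInitialSource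

theorem isInitialSource_pempty_iff {W : 𝒳} {P : PEmpty.{1} → 𝒳} {π : ∀ i, W ⟶ P i} :
    IsInitialSource p π ↔ IsRelativeTerminal p W := by
  obtain rfl : P = fun i => i.elim := funext fun i => i.elim
  obtain rfl : π = fun i => i.elim := funext fun i => i.elim
  rfl

theorem isInitialSource_bool_iff {W : 𝒳} {P : Bool → 𝒳} {π : ∀ b, W ⟶ P b} :
    IsInitialSource p π ↔ IsRelativeProduct p (π false) (π true) := by
  obtain ⟨P₀, P₁, rfl⟩ : ∃ P₀ P₁, P = pairObj P₀ P₁ :=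
    ⟨P false, P true, funext fun b => by cases b <;> rfl⟩
  have : π = pairMap (π false) (π true) := funext fun b => by cases b <;> rfl
  exact iff_of_eq (congrArg (IsInitialSource p) this)

theorem isInitialMorphism_of_isIso {P' P : 𝒳} (c : P' ⟶ P) [IsIso c] : IsInitialMorphism p c := by
  intro R g u hu
  refine ⟨u () ≫ inv c, ⟨by simp [hu], fun _ => by simp⟩, fun n hn => ?_⟩
  rw [← hn.2 (), Category.assoc, IsIso.hom_inv_id, Category.comp_id]

theorem isStronglyCartesian_map_iff {P' P : 𝒳} (c : P' ⟶ P) :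
    p.IsStronglyCartesian (p.map c) c ↔ IsInitialMorphism p c := by
  constructor
  · intro h R g u hu
    have : p.IsHomLift (g ≫ p.map c) (u ()) := by rw [← hu ()]; infer_instance
    obtain ⟨m, ⟨hm₁, hm₂⟩, hm⟩ := h.universal_property' g (u ())
    refine ⟨m, ⟨(IsHomLift.eq_of_isHomLift p g m).symm, fun _ => hm₂⟩, fun n hn => hm n ⟨?_, hn.2 ()⟩⟩
    rw [← hn.1]
    infer_instance
  · intro h
    refine ⟨fun {R} g u hu => ?_⟩
    obtain ⟨m, ⟨hm₁, hm₂⟩, hm⟩ := h g (fun _ => u)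
      (fun _ => (IsHomLift.eq_of_isHomLift p _ u).symm)
    refine ⟨m, ⟨by rw [← hm₁]; infer_instance, hm₂ ()⟩, fun n hn => hm n ⟨?_, fun _ => hn.2⟩⟩
    have := hn.1
    exact (IsHomLift.eq_of_isHomLift p g n).symm

theorem isStronglyCartesian_iff {A' A : B} (f : A' ⟶ A) {P' P : 𝒳} (c : P' ⟶ P) :
    p.IsStronglyCartesian f c ↔ p.IsHomLift f c ∧ IsInitialMorphism p c := by
  constructor
  · intro h
    refine ⟨inferInstance, ?_⟩
    subst_hom_lift p f c
    exact (isStronglyCartesian_map_iff c).1 h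
  · rintro ⟨h₁, h₂⟩
    subst_hom_lift p f c
    exact (isStronglyCartesian_map_iff c).2 h₂

theorem isHomLift_id_iff {A : B} {R W : 𝒳} (hR : p.obj R = A) (hW : p.obj W = A) (m : R ⟶ W) :
    p.IsHomLift (𝟙 A) m ↔ p.map m = eqToHom (hR.trans hW.symm) := by
  constructor
  · intro h
    rw [IsHomLift.fac' p (𝟙 A) m]
    simp
  · intro h
    exact IsHomLift.of_fac' p _ _ hR hW (by simp [h])

section Fibers

variable {A : B}

theorem Fiber.map_eq {P Q : p.Fiber A} (m : P ⟶ Q) : p.map m.1 = eqToHom (P.2.trans Q.2.symm) :=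
  (isHomLift_id_iff P.2 Q.2 m.1).1 m.2

/-- The morphism of a fiber given by a morphism over the identity. -/
def Fiber.homOfMapEq {P Q : p.Fiber A} (m : P.1 ⟶ Q.1)
    (h : p.map m = eqToHom (P.2.trans Q.2.symm)) : P ⟶ Q :=
  ⟨m, (isHomLift_id_iff P.2 Q.2 m).2 h⟩

theorem Fiber.isIso_val {P Q : p.Fiber A} (m : P ⟶ Q) [IsIso m] : IsIso m.1 :=
  inferInstanceAs (IsIso (Functor.Fiber.fiberInclusion.map m))

/-- The morphisms of the fiber are exactly those over the canonical `eqToHom`, so this is the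
relative property at that one base morphism. -/
theorem IsRelativeTerminal.isTerminal {T : p.Fiber A} (h : IsRelativeTerminal p T.1) :
    Nonempty (IsTerminal T) := by
  have key (R : p.Fiber A) := h (R := R.1) (eqToHom (R.2.trans T.2.symm)) (fun i => i.elim)
    (fun i => i.elim)
  exact ⟨IsTerminal.ofUniqueHom (fun R => Fiber.homOfMapEq _ (key R).choose_spec.1.1)
    (fun R m => Subtype.ext ((key R).choose_spec.2 m.1 ⟨Fiber.map_eq m, fun i => i.elim⟩))⟩

theorem IsRelativeProduct.isProductDiagram {W P Q : p.Fiber A} {π₁ : W ⟶ P} {π₂ : W ⟶ Q}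
    (h : IsRelativeProduct p π₁.1 π₂.1) : IsProductDiagram π₁ π₂ := by
  have key {R : p.Fiber A} (u : R ⟶ P) (v : R ⟶ Q) := h (R := R.1)
    (eqToHom (R.2.trans W.2.symm)) (pairMap u.1 v.1) (by
      rintro (_ | _) <;> simp [Fiber.map_eq])
  refine ⟨BinaryFan.IsLimit.mk _ (fun u v => Fiber.homOfMapEq _ (key u v).choose_spec.1.1)
    (fun u v => Subtype.ext ((key u v).choose_spec.1.2 false))
    (fun u v => Subtype.ext ((key u v).choose_spec.1.2 true))
    (fun u v m hu hv => Subtype.ext ((key u v).choose_spec.2 m.1 ⟨Fiber.map_eq m, ?_⟩))⟩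
  rintro (_ | _)
  · exact congrArg Subtype.val hu
  · exact congrArg Subtype.val hv

theorem IsRelativeTerminal.of_isInitialMorphism {T T₀ : 𝒳} (h : IsRelativeTerminal p T₀)
    {e : T ⟶ T₀} (he : IsInitialMorphism p e) : IsRelativeTerminal p T :=
  isInitialSource_pempty_iff.1 (IsInitialSource.precomp h he)

theorem IsRelativeTerminal.of_isIso {T T₀ : 𝒳} (h : IsRelativeTerminal p T₀) (e : T ⟶ T₀)
    [IsIso e] : IsRelativeTerminal p T :=
  h.of_isInitialMorphism (isInitialMorphism_of_isIso e)

theorem IsRelativeProduct.precomp {W P Q : 𝒳} {π₁ : W ⟶ P} {π₂ : W ⟶ Q}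
    (h : IsRelativeProduct p π₁ π₂) {W' : 𝒳} {c : W' ⟶ W} (hc : IsInitialMorphism p c) :
    IsRelativeProduct p (c ≫ π₁) (c ≫ π₂) :=
  isInitialSource_bool_iff.1 (IsInitialSource.precomp h hc)

theorem IsRelativeProduct.of_postcomp {W P Q P' Q' : 𝒳} {π₁ : W ⟶ P} {π₂ : W ⟶ Q}
    {c₁ : P ⟶ P'} {c₂ : Q ⟶ Q'} (h₁ : IsInitialMorphism p c₁) (h₂ : IsInitialMorphism p c₂)
    (h : IsRelativeProduct p (π₁ ≫ c₁) (π₂ ≫ c₂)) : IsRelativeProduct p π₁ π₂ := by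
  let c : ∀ b, pairObj P Q b ⟶ pairObj P' Q' b := Bool.rec c₁ c₂
  refine IsInitialSource.of_postcomp (c := c) (by rintro (_ | _) <;> assumption)
    (isInitialSource_bool_iff.2 h)

theorem IsRelativeTerminal.of_isTerminal {T T₀ : p.Fiber A} (h₀ : IsRelativeTerminal p T₀.1)
    (h : Nonempty (IsTerminal T)) : ∃ e : T ⟶ T₀, IsIso e := by
  obtain ⟨t⟩ := h
  obtain ⟨t₀⟩ := h₀.isTerminal
  exact ⟨(t.uniqueUpToIso t₀).hom, inferInstance⟩

theorem IsRelativeProduct.exists_iso {P Q W W₀ : p.Fiber A} {π₁ : W ⟶ P} {π₂ : W ⟶ Q}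
    {ρ₁ : W₀ ⟶ P} {ρ₂ : W₀ ⟶ Q} (h₀ : IsRelativeProduct p ρ₁.1 ρ₂.1)
    (h : IsProductDiagram π₁ π₂) :
    ∃ e : W ⟶ W₀, IsIso e ∧ e ≫ ρ₁ = π₁ ∧ e ≫ ρ₂ = π₂ := by
  obtain ⟨t⟩ := h
  obtain ⟨t₀⟩ := h₀.isProductDiagram
  exact ⟨(t.conePointUniqueUpToIso t₀).hom, inferInstance,
    t.conePointUniqueUpToIso_hom_comp t₀ ⟨WalkingPair.left⟩,
    t.conePointUniqueUpToIso_hom_comp t₀ ⟨WalkingPair.right⟩⟩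

theorem IsRelativeProduct.map_of_iso (F : 𝒳 ⥤ 𝒴) {P Q W W₀ : p.Fiber A} {π₁ : W ⟶ P} {π₂ : W ⟶ Q}
    {ρ₁ : W₀ ⟶ P} {ρ₂ : W₀ ⟶ Q} (h₀ : IsRelativeProduct q (F.map ρ₁.1) (F.map ρ₂.1))
    (e : W ⟶ W₀) [IsIso e] (e₁ : e ≫ ρ₁ = π₁) (e₂ : e ≫ ρ₂ = π₂) :
    IsRelativeProduct q (F.map π₁.1) (F.map π₂.1) := by
  have := Fiber.isIso_val e
  have := h₀.precomp (isInitialMorphism_of_isIso (F.map e.1))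
  subst e₁ e₂
  rw [← F.map_comp, ← F.map_comp] at this
  exact this

end Fibers

section Criteria

/-- A functor is a `∧`-fibration as soon as it admits initial lifts, relative terminal objects and
relative binary products. -/
theorem isWedgeFibration_of_relative
    (h₁ : ∀ (P : 𝒳) {A : B} (f : A ⟶ p.obj P), ∃ (P' : 𝒳) (c : P' ⟶ P),
      p.IsHomLift f c ∧ IsInitialMorphism p c)
    (h₂ : ∀ A : B, ∃ T : p.Fiber A, IsRelativeTerminal p T.1)
    (h₃ : ∀ {A : B} (P Q : p.Fiber A), ∃ (W : p.Fiber A) (π₁ : W ⟶ P) (π₂ : W ⟶ Q),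
      IsRelativeProduct p π₁.1 π₂.1) : IsWedgeFibration p where
  isFibered := Functor.IsFibered.of_exists_isStronglyCartesian fun P A f => by
    obtain ⟨P', c, hc⟩ := h₁ P f
    exact ⟨P', c, (isStronglyCartesian_iff f c).2 hc⟩
  fiber_fp A := by
    refine ⟨?_, ?_⟩
    · obtain ⟨T, hT⟩ := h₂ A
      exact hT.isTerminal.some.hasTerminal
    · have (P Q : p.Fiber A) : HasLimit (pair P Q) := by
        obtain ⟨W, π₁, π₂, h⟩ := h₃ P Q
        exact ⟨⟨⟨_, h.isProductDiagram.some⟩⟩⟩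
      exact hasBinaryProducts_of_hasLimit_pair _
  terminal_stable {A A'} f T T' c hc hT := by
    obtain ⟨T₀, hT₀⟩ := h₂ A
    obtain ⟨e, _⟩ := hT₀.of_isTerminal hT
    have := Fiber.isIso_val e
    exact ((hT₀.of_isIso e.1).of_isInitialMorphism
      ((isStronglyCartesian_iff f c).1 hc).2).isTerminal
  product_stable {A A'} f {P Q W P' Q' W'} π₁ π₂ π₁' π₂' cP cQ cW hP hQ hW e₁ e₂ h := by
    -- A product in the fiber is isomorphic to a relative one, hence itself relative. Precomposing
    -- with `cW` and cancelling `cP` and `cQ` leaves the diagram over `A'`.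
    obtain ⟨W₀, ρ₁, ρ₂, h₀⟩ := h₃ P Q
    obtain ⟨e, _, he₁, he₂⟩ := h₀.exists_iso h
    have hπ : IsRelativeProduct p π₁.1 π₂.1 :=
      IsRelativeProduct.map_of_iso (𝟭 𝒳) h₀ e he₁ he₂
    have := hπ.precomp ((isStronglyCartesian_iff f cW).1 hW).2
    rw [← e₁, ← e₂] at this
    exact (IsRelativeProduct.of_postcomp ((isStronglyCartesian_iff f cP).1 hP).2
      ((isStronglyCartesian_iff f cQ).1 hQ).2 this).isProductDiagram

theorem isHomLift_map (F : 𝒳 ⥤ 𝒴) (w : F ⋙ q = p) {A' A : B} (f : A' ⟶ A) {P' P : 𝒳} (c : P' ⟶ P)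
    (hc : p.IsHomLift f c) : q.IsHomLift f (F.map c) := by
  subst w
  subst_hom_lift (F ⋙ q) f c
  exact inferInstanceAs (q.IsHomLift (q.map (F.map c)) (F.map c))

/-- A functor over the base is a morphism of `∧`-fibrations as soon as it preserves enough initial
lifts, relative terminal objects and relative binary products. -/
theorem isWedgeFibrationMorphism_of_relative (hp : IsWedgeFibration p) (hq : IsWedgeFibration q)
    (F : 𝒳 ⥤ 𝒴) (w : F ⋙ q = p)
    (h₁ : ∀ (P : 𝒳) {A : B} (f : A ⟶ p.obj P), ∃ (P' : 𝒳) (c : P' ⟶ P),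
      p.IsHomLift f c ∧ IsInitialMorphism p c ∧ IsInitialMorphism q (F.map c))
    (h₂ : ∀ A : B, ∃ T : p.Fiber A, IsRelativeTerminal p T.1 ∧ IsRelativeTerminal q (F.obj T.1))
    (h₃ : ∀ {A : B} (P Q : p.Fiber A), ∃ (W : p.Fiber A) (π₁ : W ⟶ P) (π₂ : W ⟶ Q),
      IsRelativeProduct p π₁.1 π₂.1 ∧ IsRelativeProduct q (F.map π₁.1) (F.map π₂.1)) :
    IsWedgeFibrationMorphism p q F where
  source := hp
  target := hq
  comm := w
  map_cartesian {A A'} f P' P c hc := by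
    refine (isStronglyCartesian_iff f _).2 ⟨isHomLift_map F w f c hc.toIsHomLift, ?_⟩
    · subst_hom_lift p f c
      -- Cartesian lifts of one morphism are isomorphic, so it suffices that `F` preserves the given
      -- lift.
      obtain ⟨P₀, c₀, h, hc₀, hF⟩ := h₁ P (p.map c)
      have := (isStronglyCartesian_iff (p.map c) c₀).2 ⟨h, hc₀⟩
      let e := Functor.IsCartesian.domainUniqueUpToIso p (p.map c) c₀ c
      have he : e.hom ≫ c₀ = c := Functor.IsCartesian.fac p (p.map c) c₀ c
      rw [← he, F.map_comp]
      exact hF.precomp (isInitialMorphism_of_isIso (F.map e.hom))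
  fiber_fp A := by
    refine ⟨fun T hT => ?_, fun {P Q W} π₁ π₂ h => ?_⟩
    · obtain ⟨T₀, hT₀, hF⟩ := h₂ A
      obtain ⟨e, _⟩ := hT₀.of_isTerminal hT
      have := Fiber.isIso_val e
      have hT : IsRelativeTerminal q (F.obj T.1) := hF.of_isIso (F.map e.1)
      exact IsRelativeTerminal.isTerminal (T := (fiberMap F w A).obj T) hT
    · obtain ⟨W₀, ρ₁, ρ₂, h₀, hF⟩ := h₃ P Q
      obtain ⟨e, _, he₁, he₂⟩ := h₀.exists_iso h
      exact IsRelativeProduct.isProductDiagram (IsRelativeProduct.map_of_iso F hF e he₁ he₂)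

end Criteria

end InitialSources
-- Relative limits in the homotopy category
section HomotopyCategory

universe w

variable {C : Type u} [Category.{v} C] [ModelCategory C]

namespace FiberwiseHomotopic

variable {P R : Arrow C} {p q r : P ⟶ R}

theorem refl (p : P ⟶ R) : FiberwiseHomotopic p p :=
  (fiberwiseHomotopic_iff p p).2 ⟨rfl, .refl _⟩

theorem symm (h : FiberwiseHomotopic p q) : FiberwiseHomotopic q p := by
  rw [fiberwiseHomotopic_iff] at h ⊢
  exact ⟨h.1.symm, h.2.symm⟩

theorem trans [IsCofibrant P.left] [Fibration R.hom] (h : FiberwiseHomotopic p q)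
    (h' : FiberwiseHomotopic q r) : FiberwiseHomotopic p r := by
  rw [fiberwiseHomotopic_iff] at h h' ⊢
  exact ⟨h.1.trans h'.1, h.2.trans h'.2⟩

theorem precomp [IsCofibrant P.left] [Fibration R.hom] (h : FiberwiseHomotopic p q)
    {P' : Arrow C} (g : P' ⟶ P) : FiberwiseHomotopic (g ≫ p) (g ≫ q) := by
  rw [fiberwiseHomotopic_iff] at h ⊢
  exact ⟨congrArg (g.right ≫ ·) h.1, h.2.precomp g.left⟩

theorem postcomp (h : FiberwiseHomotopic p q) {R' : Arrow C} (g : R ⟶ R') :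
    FiberwiseHomotopic (p ≫ g) (q ≫ g) := by
  rw [fiberwiseHomotopic_iff] at h ⊢
  exact ⟨congrArg (· ≫ g.right) h.1, h.2.postcomp g.left g.right (Arrow.w g)⟩

/-- Fiberwise homotopies between morphisms to a relative limit are detected on the components. -/
theorem of_isInitialSource [IsCofibrant P.left] {ι : Type w} {S : ι → Arrow C}
    [∀ i, Fibration (S i).hom] {π : ∀ i, R ⟶ S i} (hπ : IsInitialSource Arrow.rightFunc π)
    (hr : p.right = q.right) (h : ∀ i, FiberwiseHomotopic (p ≫ π i) (q ≫ π i)) :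
    FiberwiseHomotopic p q := by
  -- All component homotopies are moved to this one cylinder, so that they have a common domain.
  obtain ⟨c, _⟩ := Cylinder.exists_very_good P.left
  have hk (i) := ((fiberwiseHomotopic_iff _ _).1 (h i)).2.exists_leftHomotopy c
  choose k hk using hk
  have hw (i) : (p ≫ π i).left ≫ (S i).hom = P.hom ≫ p.right ≫ (π i).right := Arrow.w (p ≫ π i)
  -- The cylinder as an object over the base of `P`: fiberwise homotopies are morphisms out of `Z`,
  -- and `j₀`, `j₁` include the ends.
  let Z : Arrow C := Arrow.mk (c.π ≫ P.hom)
  let H (i) : Z ⟶ S i := Arrow.homMk (u := (k i).h) (v := p.right ≫ (π i).right) (by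
    change (k i).h ≫ (S i).hom = (c.π ≫ P.hom) ≫ p.right ≫ (π i).right
    rw [hk, hw, Category.assoc])
  let j₀ : P ⟶ Z := Arrow.homMk (u := c.i₀) (v := 𝟙 _) (by
    change c.i₀ ≫ c.π ≫ P.hom = P.hom ≫ 𝟙 _
    simp)
  let j₁ : P ⟶ Z := Arrow.homMk (u := c.i₁) (v := 𝟙 _) (by
    change c.i₁ ≫ c.π ≫ P.hom = P.hom ≫ 𝟙 _
    simp)
  obtain ⟨m, ⟨hm₁, hm₂⟩, -⟩ := hπ (R := Z) p.right H (fun i => rfl)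
  replace hm₁ : m.right = p.right := hm₁
  have e₀ : j₀ ≫ m = p := by
    refine (hπ (R := P) p.right (fun i => p ≫ π i) (fun i => rfl)).unique
      ⟨(Category.id_comp m.right).trans hm₁, fun i => ?_⟩ ⟨rfl, fun i => rfl⟩
    rw [Category.assoc, hm₂]
    apply CommaMorphism.ext
    · exact (k i).h₀
    · exact Category.id_comp (p.right ≫ (π i).right)
  have e₁ : j₁ ≫ m = q := by
    refine (hπ (R := P) p.right (fun i => q ≫ π i) (fun i => ?_)).unique
      ⟨(Category.id_comp m.right).trans hm₁, fun i => ?_⟩ ⟨hr.symm, fun i => rfl⟩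
    · exact congrArg (· ≫ (π i).right) hr.symm
    rw [Category.assoc, hm₂]
    apply CommaMorphism.ext
    · exact (k i).h₁
    · exact (Category.id_comp (p.right ≫ (π i).right)).trans (congrArg (· ≫ (π i).right) hr)
  have hm : m.left ≫ R.hom = (c.π ≫ P.hom) ≫ m.right := Arrow.w m
  refine ⟨hr, c, ⟨m.left, congrArg CommaMorphism.left e₀, congrArg CommaMorphism.left e₁⟩, ?_⟩
  rw [hm, hm₁, Category.assoc]

end FiberwiseHomotopic

/-- Equality in the quotient category is therefore fiberwise homotopy itself, not merely the
congruence it generates. -/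
instance : Congruence (fiberwiseHomRel C) where
  equivalence {P R} := by
    have := P.property.1
    have := R.property.2
    exact ⟨fun p => .refl p.hom, fun h => FiberwiseHomotopic.symm h,
      fun h h' => FiberwiseHomotopic.trans h h'⟩
  comp_left {P R S} f g g' h := by
    have := R.property.1
    have := S.property.2
    exact FiberwiseHomotopic.precomp h f.hom
  comp_right g h := FiberwiseHomotopic.postcomp h g.hom

namespace CofibrantReplacements

variable (Q : CofibrantReplacements C)

instance (P : FibArrow C) : IsCofibrant (Q.bifib P).obj.left := (Q.bifib P).property.1

theorem fiberwiseHomotopic_comp_toArrow_iff {P : Arrow C} {P' : FibArrow C}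
    (s t : P ⟶ (Q.bifib P').obj) :
    FiberwiseHomotopic (s ≫ Q.toArrow P') (t ≫ Q.toArrow P') ↔ FiberwiseHomotopic s t := by
  refine ⟨fun h => ?_, fun h => h.postcomp _⟩
  have := Q.fibration P'
  have := Q.weakEquivalence P'
  rw [fiberwiseHomotopic_iff] at h ⊢
  refine ⟨?_, VerticallyHomotopic.of_postcomp (Q.map P') h.2⟩
  have hr : s.right ≫ 𝟙 _ = t.right ≫ 𝟙 _ := h.1
  simpa using hr

/-- Morphisms from a replacement lift along the replacement morphisms. -/
theorem exists_comp_toArrow_eq {P P' : FibArrow C} (u : (Q.bifib P).obj ⟶ P'.obj) :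
    ∃ s : Q.bifib P ⟶ Q.bifib P', s.hom ≫ Q.toArrow P' = u := by
  have := Q.fibration P'
  have := Q.weakEquivalence P'
  have sq : CommSq (initial.to (Q.obj P')) (initial.to (Q.bifib P).obj.left) (Q.map P') u.left :=
    ⟨Subsingleton.elim _ _⟩
  have e : sq.lift ≫ Q.map P' = u.left := sq.fac_right
  have hu : u.left ≫ P'.obj.hom = (Q.bifib P).obj.hom ≫ u.right := Arrow.w u
  refine ⟨ObjectProperty.homMk (Arrow.homMk (u := sq.lift) (v := u.right) ?_), ?_⟩
  · change sq.lift ≫ Q.map P' ≫ P'.obj.hom = _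
    rw [reassoc_of% e, hu]
    rfl
  · apply CommaMorphism.ext
    · exact e
    · exact Category.comp_id u.right

/-- The morphism of the homotopy category given by a morphism between replacements. -/
noncomputable def homClass {P P' : FibArrow C} (s : Q.bifib P ⟶ Q.bifib P') :
    Q.gamma.obj P ⟶ Q.gamma.obj P' :=
  InducedCategory.homMk ((CategoryTheory.Quotient.functor _).map s)

theorem exists_homClass_eq {P P' : FibArrow C} (m : Q.gamma.obj P ⟶ Q.gamma.obj P') :
    ∃ s : Q.bifib P ⟶ Q.bifib P', Q.homClass s = m := by
  obtain ⟨s, hs⟩ := (CategoryTheory.Quotient.functor (fiberwiseHomRel C)).map_surjective m.hom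
  exact ⟨s, InducedCategory.hom_ext hs⟩

/-- With `exists_comp_toArrow_eq`, this removes the replacement of the target: morphisms of the
homotopy category become homotopy classes of morphisms from `Q.bifib P` to `P'`. -/
theorem homClass_eq_iff {P P' : FibArrow C} (s t : Q.bifib P ⟶ Q.bifib P') :
    Q.homClass s = Q.homClass t ↔
      FiberwiseHomotopic (s.hom ≫ Q.toArrow P') (t.hom ≫ Q.toArrow P') := by
  rw [fiberwiseHomotopic_comp_toArrow_iff]
  refine Iff.trans ?_ (CategoryTheory.Quotient.functor_map_eq_iff (fiberwiseHomRel C) s t)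
  exact ⟨fun h => congrArg (fun f => f.hom) h, fun h => InducedCategory.hom_ext h⟩

theorem homClass_comp_gamma {P P' P'' : FibArrow C} (s : Q.bifib P ⟶ Q.bifib P') (c : P' ⟶ P'') :
    Q.homClass s ≫ Q.gamma.map c = Q.homClass (s ≫ Q.lift c) :=
  InducedCategory.hom_ext ((CategoryTheory.Quotient.functor _).map_comp s (Q.lift c)).symm

theorem comp_lift_toArrow {P P' P'' : FibArrow C} (s : Q.bifib P ⟶ Q.bifib P') (c : P' ⟶ P'') :
    (s ≫ Q.lift c).hom ≫ Q.toArrow P'' = (s.hom ≫ Q.toArrow P') ≫ c.hom := by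
  rw [ObjectProperty.FullSubcategory.comp_hom, Category.assoc, lift_spec, Category.assoc]

theorem hoFib_map_homClass {P P' : FibArrow C} (s : Q.bifib P ⟶ Q.bifib P') :
    Q.hoFib.map (Q.homClass s) = (s.hom ≫ Q.toArrow P').right :=
  (Category.comp_id s.hom.right).symm

theorem hoFib_map_gamma {P P' : FibArrow C} (c : P ⟶ P') :
    Q.hoFib.map (Q.gamma.map c) = c.hom.right := by
  have h := Q.hoFib_map_homClass (Q.lift c)
  rw [lift_spec] at h
  exact h.trans (Category.id_comp c.hom.right)

theorem gamma_comp_hoFib : Q.gamma ⋙ Q.hoFib = codFib C := by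
  refine CategoryTheory.Functor.ext (fun P => rfl) (fun P P' f => ?_)
  exact (Q.hoFib_map_gamma f).trans ((Category.id_comp _).trans (Category.comp_id _)).symm

/-- Relative limits in the arrow category which lie in the fibrant objects are relative limits in
the homotopy category. -/
theorem isInitialSource_gamma {ι : Type w} {W : FibArrow C} {P : ι → FibArrow C}
    {π : ∀ i, W ⟶ P i} (hπ : IsInitialSource Arrow.rightFunc (fun i => (π i).hom)) :
    IsInitialSource Q.hoFib (fun i => Q.gamma.map (π i)) := by
  intro R (g : R.obj.right ⟶ W.obj.right) u hu
  obtain ⟨R, rfl⟩ : ∃ R', Q.gamma.obj R' = R := ⟨R, rfl⟩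
  have hs (i) := Q.exists_homClass_eq (u i)
  choose s hs using hs
  obtain rfl : (fun i => Q.homClass (s i)) = u := funext hs
  have hs' (i) : ((s i).hom ≫ Q.toArrow (P i)).right = g ≫ (π i).hom.right := by
    rw [← hoFib_map_homClass, ← hoFib_map_gamma]
    exact hu i
  -- The representatives lie over the prescribed base morphisms on the nose, so the strict universal
  -- property applies to them.
  obtain ⟨m, ⟨hm₁, hm₂⟩, -⟩ := hπ (R := (Q.bifib R).obj) g
    (fun i => (s i).hom ≫ Q.toArrow (P i)) hs'
  obtain ⟨t, ht⟩ := Q.exists_comp_toArrow_eq m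
  have hc (n : Q.bifib R ⟶ Q.bifib W) (i) : Q.homClass n ≫ Q.gamma.map (π i) = Q.homClass (s i) ↔
      FiberwiseHomotopic ((n.hom ≫ Q.toArrow W) ≫ (π i).hom) (m ≫ (π i).hom) := by
    rw [homClass_comp_gamma, homClass_eq_iff, comp_lift_toArrow, hm₂]
  have hr (n : Q.bifib R ⟶ Q.bifib W) : Q.hoFib.map (Q.homClass n) = g ↔
      (n.hom ≫ Q.toArrow W).right = m.right := by
    rw [hoFib_map_homClass]
    exact ⟨fun h => h.trans hm₁.symm, fun h => h.trans hm₁⟩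
  refine ⟨Q.homClass t, ⟨(hr t).2 (congrArg CommaMorphism.right ht), fun i => (hc t i).2 ?_⟩, ?_⟩
  · rw [ht]
    exact .refl _
  · rintro n ⟨hn₁, hn₂⟩
    obtain ⟨n, rfl⟩ := Q.exists_homClass_eq n
    have (i : ι) : Fibration (P i).obj.hom := (P i).property
    refine (Q.homClass_eq_iff n t).2 ?_
    rw [ht]
    exact FiberwiseHomotopic.of_isInitialSource hπ ((hr n).1 hn₁) (fun i => (hc n i).1 (hn₂ i))

end CofibrantReplacements

/-- The fibrant objects form a full subcategory, so factorizations in the arrow category stay in it.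
-/
theorem isInitialSource_codFib {ι : Type w} {W : FibArrow C} {P : ι → FibArrow C}
    {π : ∀ i, W ⟶ P i} (hπ : IsInitialSource Arrow.rightFunc (fun i => (π i).hom)) :
    IsInitialSource (codFib C) π := by
  intro R g u hu
  obtain ⟨m, ⟨hm₁, hm₂⟩, hm⟩ := hπ (R := R.obj) g (fun i => (u i).hom) hu
  exact ⟨ObjectProperty.homMk m, ⟨hm₁, fun i => ObjectProperty.hom_ext _ (hm₂ i)⟩,
    fun n hn => ObjectProperty.hom_ext _ (hm n.hom
      ⟨hn.1, fun i => congrArg (fun f => f.hom) (hn.2 i)⟩)⟩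

end HomotopyCategory

/-! ### Relative limits in the arrow category -/

section RelativeLimits

variable {C : Type u} [Category.{v} C]

/-- Commutativity of the square forces the upper component to be `R.hom ≫ g`. -/
theorem isRelativeTerminal_id (A : C) :
    IsRelativeTerminal Arrow.rightFunc (Arrow.mk (𝟙 A)) := by
  intro R (g : R.right ⟶ A) u hu
  refine ⟨Arrow.homMk (u := R.hom ≫ g) (v := g) (Category.comp_id (R.hom ≫ g)),
    ⟨rfl, fun i => i.elim⟩, fun n hn => ?_⟩
  have h₁ : n.right = g := hn.1
  have h₂ : n.left ≫ 𝟙 A = R.hom ≫ n.right := Arrow.w n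
  refine CommaMorphism.ext ?_ h₁
  rw [h₁] at h₂
  exact (Category.comp_id n.left).symm.trans h₂

variable [HasFiniteLimits C]

theorem isInitialMorphism_pullback {A : C} (P : Arrow C) (f : A ⟶ P.right) :
    IsInitialMorphism Arrow.rightFunc
      (Arrow.homMk (u := pullback.fst P.hom f) (v := f) pullback.condition :
        Arrow.mk (pullback.snd P.hom f) ⟶ P) := by
  intro R (g : R.right ⟶ A) u hu
  replace hu : (u ()).right = g ≫ f := hu ()
  have hw : (u ()).left ≫ P.hom = R.hom ≫ (u ()).right := Arrow.w (u ())
  have w : (u ()).left ≫ P.hom = (R.hom ≫ g) ≫ f := by rw [hw, hu, Category.assoc]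
  refine ⟨Arrow.homMk (u := pullback.lift _ _ w) (v := g) (pullback.lift_snd _ _ w),
    ⟨rfl, fun _ => CommaMorphism.ext (pullback.lift_fst _ _ w) hu.symm⟩, fun n hn => ?_⟩
  have h₁ : n.right = g := hn.1
  have h₂ : n.left ≫ pullback.fst P.hom f = (u ()).left := congrArg CommaMorphism.left (hn.2 ())
  have h₃ : n.left ≫ pullback.snd P.hom f = R.hom ≫ n.right := Arrow.w n
  refine CommaMorphism.ext (pullback.hom_ext ?_ ?_) h₁
  · exact h₂.trans (pullback.lift_fst _ _ w).symm
  · rw [h₁] at h₃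
    exact h₃.trans (pullback.lift_snd _ _ w).symm

theorem isRelativeProduct_pullback {A X Y : C} (x : X ⟶ A) (y : Y ⟶ A) :
    IsRelativeProduct Arrow.rightFunc
      (Arrow.homMk (u := pullback.fst x y) (v := 𝟙 A) (Category.comp_id _).symm :
        Arrow.mk (pullback.fst x y ≫ x) ⟶ Arrow.mk x)
      (Arrow.homMk (u := pullback.snd x y) (v := 𝟙 A)
        (pullback.condition.symm.trans (Category.comp_id _).symm) :
        Arrow.mk (pullback.fst x y ≫ x) ⟶ Arrow.mk y) := by
  intro R (g : R.right ⟶ A) u hu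
  have hr₁ : (u false).right = g ≫ 𝟙 A := hu false
  have hr₂ : (u true).right = g ≫ 𝟙 A := hu true
  have hw₁ : (u false).left ≫ x = R.hom ≫ (u false).right := Arrow.w (u false)
  have hw₂ : (u true).left ≫ y = R.hom ≫ (u true).right := Arrow.w (u true)
  have w : (u false).left ≫ x = (u true).left ≫ y := by
    rw [hw₁, hw₂, hr₁, hr₂]
  refine ⟨Arrow.homMk (u := pullback.lift _ _ w) (v := g) ?_, ⟨rfl, ?_⟩, fun n hn => ?_⟩
  · change pullback.lift _ _ w ≫ pullback.fst x y ≫ x = R.hom ≫ g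
    rw [pullback.lift_fst_assoc, hw₁, hr₁, Category.comp_id]
  · rintro (_ | _)
    · exact CommaMorphism.ext (pullback.lift_fst _ _ w) hr₁.symm
    · exact CommaMorphism.ext (pullback.lift_snd _ _ w) hr₂.symm
  · refine CommaMorphism.ext (pullback.hom_ext ?_ ?_) hn.1
    · exact (congrArg CommaMorphism.left (hn.2 false)).trans (pullback.lift_fst _ _ w).symm
    · exact (congrArg CommaMorphism.left (hn.2 true)).trans (pullback.lift_snd _ _ w).symm

end RelativeLimits

/-! ### Relative limits of fibrations, and the two `∧`-fibrations -/

section FibrantObjects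

variable {C : Type u} [Category.{v} C] [ModelCategory C]

theorem isRelativeTerminal_codFib {T : FibArrow C}
    (h : IsRelativeTerminal Arrow.rightFunc T.obj) : IsRelativeTerminal (codFib C) T :=
  isInitialSource_codFib (P := fun i : PEmpty.{1} => i.elim) (isInitialSource_pempty_iff.2 h)

theorem isRelativeProduct_codFib {W P R : FibArrow C} {π₁ : W ⟶ P} {π₂ : W ⟶ R}
    (h : IsRelativeProduct Arrow.rightFunc π₁.hom π₂.hom) :
    IsRelativeProduct (codFib C) π₁ π₂ :=
  isInitialSource_codFib (P := pairObj P R) (π := pairMap π₁ π₂) (isInitialSource_bool_iff.2 h)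

theorem CofibrantReplacements.isRelativeTerminal_hoFib (Q : CofibrantReplacements C)
    {T : FibArrow C} (h : IsRelativeTerminal Arrow.rightFunc T.obj) :
    IsRelativeTerminal Q.hoFib (Q.gamma.obj T) :=
  isInitialSource_pempty_iff.1 (Q.isInitialSource_gamma (P := fun i : PEmpty.{1} => i.elim)
    (π := fun i => i.elim) (isInitialSource_pempty_iff.2 h))

theorem CofibrantReplacements.isRelativeProduct_hoFib (Q : CofibrantReplacements C)
    {W P R : FibArrow C} {π₁ : W ⟶ P} {π₂ : W ⟶ R}
    (h : IsRelativeProduct Arrow.rightFunc π₁.hom π₂.hom) :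
    IsRelativeProduct Q.hoFib (Q.gamma.map π₁) (Q.gamma.map π₂) :=
  isInitialSource_bool_iff.1 (Q.isInitialSource_gamma (P := pairObj P R) (π := pairMap π₁ π₂)
    (isInitialSource_bool_iff.2 h))

/-- A base change of a fibration is a fibration. Initiality is asserted in the whole arrow category,
so that it transfers both to `codFib C` and to `Q.hoFib`. -/
theorem exists_initialLift (P : FibArrow C) {A : C} (f : A ⟶ (codFib C).obj P) :
    ∃ (P' : FibArrow C) (c : P' ⟶ P),
      (codFib C).IsHomLift f c ∧ IsInitialMorphism Arrow.rightFunc c.hom := by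
  have : Fibration P.obj.hom := P.property
  let f' : A ⟶ P.obj.right := f
  let P' : FibArrow C := ⟨Arrow.mk (pullback.snd P.obj.hom f'),
    inferInstanceAs (Fibration (pullback.snd P.obj.hom f'))⟩
  let c : P' ⟶ P := ObjectProperty.homMk
    (Arrow.homMk (u := pullback.fst P.obj.hom f') (v := f') pullback.condition)
  exact ⟨P', c, inferInstanceAs ((codFib C).IsHomLift ((codFib C).map c) c),
    isInitialMorphism_pullback P.obj f'⟩

theorem exists_relativeTerminal (A : C) :
    ∃ T : (codFib C).Fiber A, IsRelativeTerminal Arrow.rightFunc T.1.obj :=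
  ⟨⟨⟨Arrow.mk (𝟙 A), inferInstanceAs (Fibration (𝟙 A))⟩, rfl⟩, isRelativeTerminal_id A⟩

theorem exists_relativeProduct {A : C} (P R : (codFib C).Fiber A) :
    ∃ (W : (codFib C).Fiber A) (π₁ : W ⟶ P) (π₂ : W ⟶ R),
      IsRelativeProduct Arrow.rightFunc π₁.1.hom π₂.1.hom := by
  obtain ⟨⟨⟨X, A', x⟩, hx⟩, hA'⟩ := P
  obtain ⟨⟨⟨Y, A'', y⟩, hy⟩, hA''⟩ := R
  change A' = A at hA'
  change A'' = A at hA''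
  subst hA' hA''
  have : Fibration x := hx
  have : Fibration y := hy
  let W : (codFib C).Fiber A'' := ⟨⟨Arrow.mk (pullback.fst x y ≫ x),
    inferInstanceAs (Fibration (pullback.fst x y ≫ x))⟩, rfl⟩
  let π₁ : W.1 ⟶ ⟨Arrow.mk x, hx⟩ := ObjectProperty.homMk
    (Arrow.homMk (u := pullback.fst x y) (v := 𝟙 A'') (Category.comp_id _).symm)
  let π₂ : W.1 ⟶ ⟨Arrow.mk y, hy⟩ := ObjectProperty.homMk
    (Arrow.homMk (u := pullback.snd x y) (v := 𝟙 A'')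
      (pullback.condition.symm.trans (Category.comp_id _).symm))
  exact ⟨W, ⟨π₁, inferInstanceAs ((codFib C).IsHomLift ((codFib C).map π₁) π₁)⟩,
    ⟨π₂, inferInstanceAs ((codFib C).IsHomLift ((codFib C).map π₂) π₂)⟩,
    isRelativeProduct_pullback x y⟩

theorem isWedgeFibration_codFib : IsWedgeFibration (codFib C) := by
  refine isWedgeFibration_of_relative (fun P A f => ?_) (fun A => ?_) (fun {A} P R => ?_)
  · obtain ⟨P', c, hf, hc⟩ := exists_initialLift P f
    exact ⟨P', c, hf, isInitialSource_codFib hc⟩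
  · obtain ⟨T, hT⟩ := exists_relativeTerminal A
    exact ⟨T, isRelativeTerminal_codFib hT⟩
  · obtain ⟨W, π₁, π₂, h⟩ := exists_relativeProduct P R
    exact ⟨W, π₁, π₂, isRelativeProduct_codFib h⟩

theorem CofibrantReplacements.isWedgeFibration_hoFib (Q : CofibrantReplacements C) :
    IsWedgeFibration Q.hoFib := by
  refine isWedgeFibration_of_relative (fun P A f => ?_) (fun A => ?_) (fun {A} P R => ?_)
  · obtain ⟨P', c, hf, hc⟩ := exists_initialLift (C := C) P f
    exact ⟨_, Q.gamma.map c, isHomLift_map Q.gamma Q.gamma_comp_hoFib f c hf,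
      Q.isInitialSource_gamma hc⟩
  · obtain ⟨T, hT⟩ := exists_relativeTerminal A
    exact ⟨(fiberMap Q.gamma Q.gamma_comp_hoFib A).obj T, Q.isRelativeTerminal_hoFib hT⟩
  · obtain ⟨W, π₁, π₂, h⟩ := exists_relativeProduct (C := C) ⟨P.1, P.2⟩ ⟨R.1, R.2⟩
    let G := fiberMap Q.gamma Q.gamma_comp_hoFib A
    exact ⟨G.obj W, G.map π₁, G.map π₂, Q.isRelativeProduct_hoFib h⟩

end FibrantObjects

end WedgeFib

theorem proposition4p5p5 {C : Type u} [Category.{v} C] [ModelCategory C]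
    (Q : WedgeFib.CofibrantReplacements C) :
    WedgeFib.IsWedgeFibration Q.hoFib ∧
      WedgeFib.IsWedgeFibrationMorphism (WedgeFib.codFib C) Q.hoFib Q.gamma := by
  refine ⟨Q.isWedgeFibration_hoFib, WedgeFib.isWedgeFibrationMorphism_of_relative
    WedgeFib.isWedgeFibration_codFib Q.isWedgeFibration_hoFib Q.gamma Q.gamma_comp_hoFib
    (fun P A f => ?_) (fun A => ?_) (fun {A} P R => ?_)⟩
  · obtain ⟨P', c, hf, hc⟩ := WedgeFib.exists_initialLift P f
    exact ⟨P', c, hf, WedgeFib.isInitialSource_codFib hc, Q.isInitialSource_gamma hc⟩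
  · obtain ⟨T, hT⟩ := WedgeFib.exists_relativeTerminal A
    exact ⟨T, WedgeFib.isRelativeTerminal_codFib hT, Q.isRelativeTerminal_hoFib hT⟩
  · obtain ⟨W, π₁, π₂, h⟩ := WedgeFib.exists_relativeProduct P R
    exact ⟨W, π₁, π₂, WedgeFib.isRelativeProduct_codFib h, Q.isRelativeProduct_hoFib h⟩
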